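/- For positive integers $\beta,n$ and integers $1\le s_1<s_2<\dots<s_k$, $\;1\le\alpha_1<\alpha_2<\dots<\alpha_\ell\le\lfloor\beta/2\rfloor$ ($k,\ell\ge 0$) with $s_k\le\lfloor\beta n/2\rfloor$ (no condition if $k=0$), let $$G_n=C_{\beta n}(s_1,\dots,s_k,\alpha_1n,\dots,\alpha_\ell n)$$ be the circulant multigraph with vertex set $\mathbb{Z}/\beta n\mathbb{Z}$ in which, for every vertex $x$ and every jump $j$ in the list $s_1,\dots,s_k,\alpha_1n,\dots,\alpha_\ell n$, there is one edge joining $x$ and $x+j$ (so $G_n$ is regular of degree $2(k+\ell)$, a jump equal to $\beta n/2$ gives double edges, and a value occurring twice in the list gives parallel edges). Let $\tau(n)$ be the number of spanning trees of $G_n$ (which is $0$ if $G_n$ is disconnected). Fix $\beta$, $s_1,\dots,s_k$ and $\alpha_1,\dots,\alpha_\ell$. Let $p$ be the number of odd elements among $s_1,\dots,s_k$ and $q$ the number of odd elements among $\alpha_1,\dots,\alpha_\ell$. Let $r$ be the square-free part of $p$ and $s$ the square-free part of $p+q$, where the square-free part of a positive integer $m$ is the unique square-free positive integer $d$ with $m=d\,u^2$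 for some integer $u$; for $m=0$ any square-free positive integer $d$ may be taken. Then there is a sequence of integers $a(n)$ such that for every $n\ge 1$ with $s_k\le\lfloor\beta n/2\rfloor$: 1. $\tau(n)=\beta\,n\,a(n)^2$ if $n$ and $\beta$ are odd; 2. $\tau(n)=\beta\,r\,n\,a(n)^2$ if $n$ is even; 3. $\tau(n)=\beta\,s\,n\,a(n)^2$ if $n$ is odd and $\beta$ is even. -/

import Mathlib

open scoped Graph

/-- The circulant multigraph `C_N(j_i : i ∈ ι)`. Its vertices are the residues modulo `N`; for every
residue `x` and every index `i` there is one edge `(x, i)`, which joins `x` and `x + j_i`. Thus the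
number of edges between `x` and `y` is counted by the matrix `∑ i, (T ^ j_i + T ^ (-j_i))`, where
`T` is the cyclic shift (in particular, a jump `N / 2` gives double edges, and equal jumps give
parallel edges). -/
def circulantMultigraph (N : ℕ) {ι : Type*} (j : ι → ℕ) : Graph (ZMod N) (ZMod N × ι) where
  vertexSet := Set.univ
  IsLink e x y := s(e.1, e.1 + (j e.2 : ZMod N)) = s(x, y)
  isLink_symm _ _ := ⟨fun _ _ h => h.trans Sym2.eq_swap⟩
  eq_or_eq_of_isLink_of_isLink e x y v w h h' := by
    have h2 : s(x, y) = s(v, w) := h.symm.trans h'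
    rw [Sym2.eq_iff] at h2
    rcases h2 with h2 | h2
    · exact Or.inl h2.1
    · exact Or.inr h2.1
  left_mem_of_isLink _ _ _ _ := Set.mem_univ _

/-- `H` is a spanning tree of the multigraph `G`: a subgraph on all vertices of `G`, without loops
and parallel edges, that is a tree. -/
structure IsSpanningTree {V E : Type*} (H G : Graph V E) : Prop where
  spanning : H ≤s G
  simple : H.Simple
  isTree : H.toSimpleGraph.IsTree

/-- The number of spanning trees of a multigraph (used for finite multigraphs only). -/
noncomputable def numSpanningTrees {V E : Type*} (G : Graph V E) : ℕ :=
  Nat.card {H : Graph V E // IsSpanningTree H G}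

/-- The circulant graph `C_{βn}(s_1, …, s_k, α_1 n, …, α_l n)` with non-fixed jumps. -/
def circulantNonFixed (β n : ℕ) {k l : ℕ} (s : Fin k → ℕ) (α : Fin l → ℕ) :
    Graph (ZMod (β * n)) (ZMod (β * n) × (Fin k ⊕ Fin l)) :=
  circulantMultigraph (β * n) (Sum.elim s (fun m => α m * n))

/-- The number of odd terms of a finite sequence. -/
def numOdd {k : ℕ} (s : Fin k → ℕ) : ℕ :=
  (Finset.univ.filter (fun i => Odd (s i))).card

/-- `d` is the square-free part of `m`: `d` is square-free and `m = d u²`. For `m > 0` there is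
exactly one such `d`; for `m = 0` every square-free `d` is allowed. -/
def IsSquarefreePart (d m : ℕ) : Prop :=
  Squarefree d ∧ ∃ u : ℕ, m = d * u ^ 2

/-! Put N = βn. Kirchhoff's theorem (`det_reduced_laplacian`) and diagonalization by the characters
of ℤ/N give N·τ = ∏_{k≠0} λ_k (`card_mul_card_treeEdges`). Since λ_{-k} = λ_k, the right side is the
square of a half product, times λ_{N/2} when N is even; and λ_{N/2} is 4 times the number of odd
jumps (`circEigenvalue_half`).

The half product is rational: a Galois automorphism of the N-th cyclotomic field sends λ_a to λ_{ua}
for a unit u, and multiplication by u permutes the nonzero residues up to sign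
(`prod_half_unit_mul`, `exists_rat_eq_half_product`). Hence N·τ = D·c² with c rational, where D is 1
for N odd, p for n even (every α_m n is then even), and p + q for n odd and β even.

Translations show N ∣ τ (`dvd_card_treeEdges`). So with D = d·u² the integer τ/N equals d times the
rational square (uc/N)², and since d is square-free, uc/N is an integer (`exists_eq_mul_sq`). -/

/-! ### Cauchy–Binet. -/

-- Cauchy–Binet in a form that needs no ordering of the columns: each column set is counted once per
-- enumeration, whence the factorial. Multilinearity in the rows leaves one determinant per f;
-- averaging over precompositions of f with permutations produces the second.
open scoped Nat in
theorem factorial_mul_det_mul_transpose {m E R : Type*} [Fintype m] [DecidableEq m] [Fintype E]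
    [DecidableEq E] [CommRing R] (A : Matrix m E R) :
    ((Fintype.card m)! : R) * (A * A.transpose).det =
      ∑ f : m → E, (A.submatrix id f).det ^ 2 := by
  have expand : (A * A.transpose).det =
      ∑ f : m → E, (∏ i, A i (f i)) * (A.submatrix id f).det := by
    have hrow : A * A.transpose = fun i => ∑ e, A i e • A.transpose e := by
      ext i j
      simp [Matrix.mul_apply, Finset.sum_apply]
    have h2 := (Matrix.detRowAlternating (n := m) (R := R)).toMultilinearMap.map_sum
      (fun i e => A i e • A.transpose e)
    change Matrix.detRowAlternating (A * A.transpose) = _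
    rw [hrow]
    refine h2.trans (Finset.sum_congr rfl fun f _ => ?_)
    rw [MultilinearMap.map_smul_univ, smul_eq_mul, ← Matrix.det_transpose (A.submatrix id f)]
    rfl
  have perm (σ : Equiv.Perm m) : (A * A.transpose).det =
      ∑ f : m → E, (∏ i, A i (f (σ i))) * ((Equiv.Perm.sign σ : ℤ) * (A.submatrix id f).det) := by
    rw [expand, ← Equiv.sum_comp (Equiv.arrowCongr σ.symm (Equiv.refl E))]
    refine Finset.sum_congr rfl fun f _ => ?_
    have : A.submatrix id (Equiv.arrowCongr σ.symm (Equiv.refl E) f) =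
        (A.submatrix id f).submatrix id σ := by
      ext i j; simp [Equiv.arrowCongr]
    rw [this, Matrix.det_permute']
    simp [Equiv.arrowCongr]
  have total : ∑ _σ : Equiv.Perm m, (A * A.transpose).det =
      ∑ f : m → E, (A.submatrix id f).det ^ 2 := by
    rw [Finset.sum_congr rfl fun σ _ => perm σ, Finset.sum_comm]
    refine Finset.sum_congr rfl fun f _ => ?_
    have h : (A.submatrix id f).det =
        ∑ σ : Equiv.Perm m, (Equiv.Perm.sign σ : ℤ) * ∏ i, A i (f (σ i)) := by
      rw [← Matrix.det_transpose, Matrix.det_apply']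
      rfl
    rw [sq]
    nth_rw 2 [h]
    rw [Finset.sum_mul]
    refine Finset.sum_congr rfl fun σ _ => ?_
    ring
  rw [← total, Finset.sum_const, Finset.card_univ, Fintype.card_perm, nsmul_eq_mul]

/-! ### The matrix-tree theorem. -/

section Kirchhoff

variable {V E : Type*}

/-- The simple graph underlying the set `F` of edges, where `e` joins `src e` and `tgt e`. -/
def edgeGraph (src tgt : E → V) (F : Finset E) : SimpleGraph V :=
  SimpleGraph.fromRel fun x y => ∃ e ∈ F, src e = x ∧ tgt e = y

/-- The edges in `F` form a spanning tree. -/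
def IsTreeEdges [Fintype V] (src tgt : E → V) (F : Finset E) : Prop :=
  F.card + 1 = Fintype.card V ∧ (edgeGraph src tgt F).Connected

/-- The signed incidence matrix. -/
def signedInc [DecidableEq V] (src tgt : E → V) : Matrix V E ℤ :=
  Matrix.of fun v e => (if tgt e = v then 1 else 0) - (if src e = v then 1 else 0)

/-- The signed sum of the edges of a walk has boundary end minus start. -/
theorem exists_combination_of_reachable [DecidableEq V] [Fintype E] [DecidableEq E]
    (src tgt : E → V) (F : Finset E) {x y : V} (h : (edgeGraph src tgt F).Reachable x y) :
    ∃ c : E → ℤ, (∀ e ∉ F, c e = 0) ∧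
      ∀ v, ∑ e, signedInc src tgt v e * c e = (if y = v then 1 else 0) - (if x = v then 1 else 0) := by
  obtain ⟨w⟩ := h
  induction w with
  | nil => exact ⟨0, by simp, by simp⟩
  | @cons a b _ hab _ ih =>
    obtain ⟨c, hc, hcv⟩ := ih
    rw [edgeGraph, SimpleGraph.fromRel_adj] at hab
    rcases hab.2 with ⟨e, he, h1, h2⟩ | ⟨e, he, h1, h2⟩
    · refine ⟨c + Pi.single e 1, fun e' he' => ?_, fun v => ?_⟩
      · have : e' ≠ e := by rintro rfl; exact he' he
        simp [hc e' he', this]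
      · simp only [Pi.add_apply, mul_add, Finset.sum_add_distrib, hcv]
        simp [Pi.single_apply, signedInc, h1, h2]
    · refine ⟨c - Pi.single e 1, fun e' he' => ?_, fun v => ?_⟩
      · have : e' ≠ e := by rintro rfl; exact he' he
        simp [hc e' he', this]
      · simp only [Pi.sub_apply, mul_sub, Finset.sum_sub_distrib, hcv]
        simp [Pi.single_apply, signedInc, h1, h2]

variable [Fintype V] [DecidableEq V] [DecidableEq E]

/-- Walks from r to the other vertices supply the columns of an integral inverse, so the determinant
is a unit of ℤ. -/
theorem det_sq_eq_one_of_connected [Fintype E] (src tgt : E → V) (r : V) (f : {v // v ≠ r} → E)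
    (hf : Function.Injective f)
    (hc : (edgeGraph src tgt (Finset.univ.image f)).Connected) :
    ((signedInc src tgt).submatrix (Subtype.val : {v // v ≠ r} → V) f).det ^ 2 = 1 := by
  choose c hc0 hcv using fun x : {v // v ≠ r} =>
    exists_combination_of_reachable src tgt _ (hc.preconnected r x)
  have hinv : (signedInc src tgt).submatrix (Subtype.val : {v // v ≠ r} → V) f *
      (Matrix.of fun i x => c x (f i)) = 1 := by
    ext v x
    rw [Matrix.mul_apply]
    have h1 : ∑ i, signedInc src tgt v.1 (f i) * c x (f i) =
        ∑ e, signedInc src tgt v.1 e * c x e := by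
      rw [← Finset.sum_image (s := Finset.univ) (g := f)
        (f := fun e => signedInc src tgt v.1 e * c x e) (fun a _ b _ h => hf h)]
      refine Finset.sum_subset (Finset.subset_univ _) fun e _ he => ?_
      rw [hc0 x e he, mul_zero]
    simp only [Matrix.submatrix_apply, Matrix.of_apply]
    rw [h1, hcv, if_neg v.2.symm, sub_zero, Matrix.one_apply]
    simp only [Subtype.ext_iff, eq_comm]
  have := congrArg Matrix.det hinv
  rw [Matrix.det_mul, Matrix.det_one] at this
  exact Int.isUnit_sq (IsUnit.of_mul_eq_one _ this)

/-- The indicator of a component avoiding r is a nonzero left null vector: no chosen edge leaves the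
component, and deleting row r loses nothing. -/
theorem det_eq_zero_of_not_connected (src tgt : E → V) (r : V) (f : {v // v ≠ r} → E)
    (hc : ¬ (edgeGraph src tgt (Finset.univ.image f)).Connected) :
    ((signedInc src tgt).submatrix (Subtype.val : {v // v ≠ r} → V) f).det = 0 := by
  classical
  set G := edgeGraph src tgt (Finset.univ.image f) with hG
  obtain ⟨x, hx⟩ : ∃ x, ¬ G.Reachable r x := by
    by_contra! h
    exact hc ((SimpleGraph.connected_iff _).2 ⟨fun a b => (h a).symm.trans (h b), ⟨r⟩⟩)
  let w : V → ℤ := fun v => if G.Reachable v x then 1 else 0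
  rw [← Matrix.exists_vecMul_eq_zero_iff]
  refine ⟨fun v => w v, fun h => ?_, ?_⟩
  · have hxr : x ≠ r := by rintro rfl; exact hx (SimpleGraph.Reachable.refl _)
    have := congrFun h ⟨x, hxr⟩
    simp [w] at this
  · ext i
    have hadd : ∑ v, w v * signedInc src tgt v (f i) =
        ∑ v : {v // v ≠ r}, w v * signedInc src tgt v (f i) := by
      rw [Fintype.sum_eq_add_sum_subtype_ne _ r]
      simp [w, hx]
    have hend : w (tgt (f i)) = w (src (f i)) := by
      by_cases h : src (f i) = tgt (f i)
      · rw [h]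
      · have hadj : G.Adj (src (f i)) (tgt (f i)) := by
          rw [hG, edgeGraph, SimpleGraph.fromRel_adj]
          exact ⟨h, Or.inl ⟨f i, Finset.mem_image_of_mem f (Finset.mem_univ i), rfl, rfl⟩⟩
        have hiff : G.Reachable (tgt (f i)) x ↔ G.Reachable (src (f i)) x :=
          ⟨fun h => hadj.reachable.trans h, fun h => hadj.reachable.symm.trans h⟩
        simp only [w, hiff]
    change ∑ v : {v // v ≠ r}, w v * signedInc src tgt v (f i) = 0
    rw [← hadd]
    simp [signedInc, mul_sub, hend]

/-- This count cancels the factorial in `factorial_mul_det_mul_transpose`. -/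
theorem card_embeddings_image_eq {E m : Type*} [Fintype E] [DecidableEq E] [Fintype m]
    [DecidableEq m] (F : Finset E)
    (hF : F.card = Fintype.card m) [DecidablePred fun f : m → E => Function.Injective f] :
    (Finset.univ.filter fun f : m → E => Function.Injective f ∧ Finset.univ.image f = F).card =
      (Fintype.card m).factorial := by
  have hcard : Fintype.card m = Fintype.card F := by rw [Fintype.card_coe, hF]
  rw [← Fintype.card_equiv (Fintype.equivOfCardEq hcard), ← Finset.card_univ]
  symm
  refine Finset.card_nbij (fun e i => (e i : E)) ?_ ?_ ?_
  · intro e _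
    simp only [Finset.coe_filter, Finset.mem_univ, true_and, Set.mem_ofPred_eq]
    refine ⟨fun a b h => e.injective (Subtype.ext h), ?_⟩
    ext x
    simp only [Finset.mem_image, Finset.mem_univ, true_and]
    exact ⟨by rintro ⟨a, rfl⟩; exact (e a).2, fun hx => ⟨e.symm ⟨x, hx⟩, by simp⟩⟩
  · intro e _ e' _ h
    ext i
    exact congrFun h i
  · intro f hf
    simp only [Finset.coe_filter, Finset.mem_univ, true_and, Set.mem_ofPred_eq] at hf
    have hmem : ∀ i, f i ∈ F := fun i => hf.2 ▸ Finset.mem_image_of_mem f (Finset.mem_univ i)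
    have hbij : Function.Bijective (fun i => (⟨f i, hmem i⟩ : F)) :=
      (Fintype.bijective_iff_injective_and_card _).2
        ⟨fun a b h => hf.1 (congrArg Subtype.val h), hcard⟩
    exact ⟨Equiv.ofBijective _ hbij, Finset.mem_coe.2 (Finset.mem_univ _), rfl⟩

/-- **Kirchhoff's theorem**: the reduced Laplacian determinant counts spanning trees. -/
theorem det_reduced_laplacian [Fintype E] (src tgt : E → V) (r : V)
    [DecidablePred (IsTreeEdges src tgt)] :
    ((signedInc src tgt * (signedInc src tgt).transpose).submatrix
      (Subtype.val : {v // v ≠ r} → V) Subtype.val).det =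
      ((Finset.univ.filter (IsTreeEdges src tgt)).card : ℤ) := by
  classical
  set m := {v // v ≠ r}
  set A : Matrix m E ℤ := (signedInc src tgt).submatrix Subtype.val id with hA
  have hm : Fintype.card m + 1 = Fintype.card V := by
    rw [Fintype.card_subtype_compl, Fintype.card_subtype_eq]
    have : 0 < Fintype.card V := Fintype.card_pos_iff.2 ⟨r⟩
    omega
  have hL : (signedInc src tgt * (signedInc src tgt).transpose).submatrix
      (Subtype.val : m → V) Subtype.val = A * A.transpose := rfl
  have hterm (f : m → E) : (A.submatrix id f).det ^ 2 =
      if Function.Injective f ∧ IsTreeEdges src tgt (Finset.univ.image f) then 1 else 0 := by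
    by_cases hf : Function.Injective f
    · have hcard : (Finset.univ.image f).card + 1 = Fintype.card V := by
        rw [Finset.card_image_of_injective _ hf, Finset.card_univ, hm]
      by_cases hc : (edgeGraph src tgt (Finset.univ.image f)).Connected
      · rw [if_pos ⟨hf, hcard, hc⟩]
        exact det_sq_eq_one_of_connected src tgt r f hf hc
      · rw [if_neg fun h => hc h.2.2]
        have : (A.submatrix id f).det = 0 := det_eq_zero_of_not_connected src tgt r f hc
        rw [this]; norm_num
    · rw [if_neg fun h => hf h.1]
      obtain ⟨a, b, hab, hne⟩ := Function.not_injective_iff.1 hf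
      rw [Matrix.det_zero_of_column_eq hne fun k => by simp [hab]]
      norm_num
  have hcount : (Finset.univ.filter fun f : m → E =>
      Function.Injective f ∧ IsTreeEdges src tgt (Finset.univ.image f)).card =
      (Finset.univ.filter (IsTreeEdges src tgt)).card * (Fintype.card m).factorial := by
    rw [Finset.card_eq_sum_card_fiberwise (f := fun f => Finset.univ.image f)
      (t := Finset.univ.filter (IsTreeEdges src tgt)) (fun f hf => by simpa using (by simpa using hf :
        Function.Injective f ∧ IsTreeEdges src tgt (Finset.univ.image f)).2)]
    rw [Finset.sum_const_nat]
    intro F hF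
    have hF' : IsTreeEdges src tgt F := (Finset.mem_filter.1 hF).2
    rw [← card_embeddings_image_eq F (m := m) (by have := hF'.1; omega), Finset.filter_filter]
    congr 1
    ext f
    simp only [Finset.mem_filter, Finset.mem_univ, true_and]
    constructor
    · rintro ⟨⟨h1, _⟩, h3⟩; exact ⟨h1, h3⟩
    · rintro ⟨h1, h3⟩; exact ⟨⟨h1, h3 ▸ hF'⟩, h3⟩
  have key := factorial_mul_det_mul_transpose A
  rw [Finset.sum_congr rfl fun f _ => hterm f, Finset.sum_boole, hcount, Nat.cast_mul,
    mul_comm] at key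
  rw [hL]
  exact mul_right_cancel₀ (by exact_mod_cast Nat.factorial_ne_zero _) key

end Kirchhoff

/-! ### Spanning trees as subgraphs versus sets of edges. -/

section Bridge

variable {V E : Type*}

theorem Graph.toSimpleGraph_adj_iff_of_isLink [DecidableEq E] {G H : Graph V E} (src tgt : E → V)
    (hG : ∀ e x y, G.IsLink e x y ↔ s(src e, tgt e) = s(x, y)) (hH : H ≤ G) (F : Finset E)
    (hF : E(H) = F) (u v : V(H)) :
    (edgeGraph src tgt F).Adj u v ↔ H.toSimpleGraph.Adj u v := by
  rw [edgeGraph, SimpleGraph.fromRel_adj, Graph.toSimpleGraph_adj, Ne, Ne, Subtype.ext_iff]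
  refine and_congr_right fun _ => ⟨?_, ?_⟩
  · rintro (⟨e, he, h1, h2⟩ | ⟨e, he, h1, h2⟩)
    · exact ⟨e, (hH.isLink_iff (by rw [hF]; exact he)).2 ((hG _ _ _).2 (by rw [h1, h2]))⟩
    · exact ⟨e, (hH.isLink_iff (by rw [hF]; exact he)).2
        ((hG _ _ _).2 (by rw [h1, h2, Sym2.eq_swap]))⟩
  · rintro ⟨e, he⟩
    have hmem : e ∈ F := by have := he.edge_mem; rwa [hF] at this
    have := (hG _ _ _).1 (he.mono hH)
    rw [Sym2.eq_iff] at this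
    rcases this with ⟨h1, h2⟩ | ⟨h1, h2⟩
    · exact Or.inl ⟨e, hmem, h1, h2⟩
    · exact Or.inr ⟨e, hmem, h1, h2⟩

/-- Only an inclusion, because loops in F leave no trace in the simple graph. -/
theorem edgeGraph_edgeSet_subset [DecidableEq E] [DecidableEq V] (src tgt : E → V) (F : Finset E) :
    (edgeGraph src tgt F).edgeSet ⊆ ((F.image fun e => s(src e, tgt e) : Finset (Sym2 V)) :
      Set (Sym2 V)) := by
  intro z hz
  induction z with
  | h x y =>
    rw [SimpleGraph.mem_edgeSet, edgeGraph, SimpleGraph.fromRel_adj] at hz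
    rw [Finset.mem_coe, Finset.mem_image]
    rcases hz.2 with ⟨e, he, h1, h2⟩ | ⟨e, he, h1, h2⟩
    · exact ⟨e, he, by rw [h1, h2]⟩
    · exact ⟨e, he, by rw [h1, h2, Sym2.eq_swap]⟩

variable [Fintype V]

/-- A spanning connected set of `|V| - 1` edges has neither loops nor parallel edges. -/
theorem IsTreeEdges.injOn_and_edgeSet_eq [DecidableEq E] [DecidableEq V] {src tgt : E → V}
    {F : Finset E} (h : IsTreeEdges src tgt F) :
    Set.InjOn (fun e => s(src e, tgt e)) (F : Set E) ∧
      (edgeGraph src tgt F).edgeSet = (F.image fun e => s(src e, tgt e) : Finset (Sym2 V)) := by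
  -- Connectedness forces at least |V| - 1 simple edges, while F has only |V| - 1 members, so every
  -- inequality between the edge set, the image of F and F is an equality.
  have h1 := h.2.card_vert_le_card_edgeSet_add_one
  rw [Nat.card_eq_fintype_card, ← h.1, add_le_add_iff_right, Nat.card_coe_set_eq] at h1
  have hsub := edgeGraph_edgeSet_subset src tgt F
  have h2 := Set.ncard_le_ncard hsub (Finset.finite_toSet _)
  rw [Set.ncard_coe_finset] at h2
  have h3 : (F.image fun e => s(src e, tgt e)).card ≤ F.card := Finset.card_image_le
  refine ⟨Finset.card_image_iff.1 (by omega), ?_⟩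
  refine Set.eq_of_subset_of_ncard_le hsub ?_ (Finset.finite_toSet _)
  rw [Set.ncard_coe_finset]; omega

theorem IsTreeEdges.isTree [DecidableEq E] {src tgt : E → V}
    {F : Finset E} (h : IsTreeEdges src tgt F) : (edgeGraph src tgt F).IsTree := by
  classical
  rw [SimpleGraph.isTree_iff_connected_and_card]
  obtain ⟨h1, h2⟩ := h.injOn_and_edgeSet_eq
  refine ⟨h.2, ?_⟩
  rw [Nat.card_coe_set_eq, h2, Set.ncard_coe_finset, Finset.card_image_of_injOn h1,
    Nat.card_eq_fintype_card, h.1]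

variable [DecidableEq E] {G : Graph V E} {src tgt : E → V}

/-- The simple graph of a spanning subgraph is the graph of its edge set. -/
def spanningIso (hV : V(G) = Set.univ) (hG : ∀ e x y, G.IsLink e x y ↔ s(src e, tgt e) = s(x, y))
    {H : Graph V E} (hH : H ≤s G) (F : Finset E) (hF : E(H) = F) :
    H.toSimpleGraph ≃g edgeGraph src tgt F where
  toEquiv := (Equiv.setCongr (hH.vertexSet_eq.trans hV)).trans (Equiv.Set.univ V)
  map_rel_iff' {u v} := Graph.toSimpleGraph_adj_iff_of_isLink src tgt hG hH.le F hF u v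

/-- Simplicity makes edges correspond bijectively to adjacent pairs, so the edge count of a tree
passes to F. -/
theorem isTreeEdges_of_isSpanningTree (hV : V(G) = Set.univ)
    (hG : ∀ e x y, G.IsLink e x y ↔ s(src e, tgt e) = s(x, y))
    {H : Graph V E} (hH : IsSpanningTree H G) (F : Finset E) (hF : E(H) = F) :
    IsTreeEdges src tgt F := by
  classical
  have htree := (spanningIso hV hG hH.spanning F hF).isTree_iff.1 hH.isTree
  have hlink : ∀ e ∈ F, H.IsLink e (src e) (tgt e) := fun e he =>
    (hH.spanning.le.isLink_iff (by rw [hF]; exact he)).2 ((hG _ _ _).2 rfl)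
  have hsimple := hH.simple
  have hinj : Set.InjOn (fun e => s(src e, tgt e)) (F : Set E) := by
    intro e he e' he' h
    exact (hlink e he).eq ((hH.spanning.le.isLink_iff (by rw [hF]; exact he')).2
      ((hG _ _ _).2 h.symm))
  have hset : (edgeGraph src tgt F).edgeSet =
      (F.image fun e => s(src e, tgt e) : Finset (Sym2 V)) := by
    refine (edgeGraph_edgeSet_subset src tgt F).antisymm fun z hz => ?_
    obtain ⟨e, he, rfl⟩ := Finset.mem_image.1 (Finset.mem_coe.1 hz)
    rw [SimpleGraph.mem_edgeSet, edgeGraph, SimpleGraph.fromRel_adj]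
    exact ⟨(hlink e he).ne, Or.inl ⟨e, he, rfl, rfl⟩⟩
  refine ⟨?_, htree.connected⟩
  have := (SimpleGraph.isTree_iff_connected_and_card.1 htree).2
  rwa [Nat.card_coe_set_eq, hset, Set.ncard_coe_finset, Finset.card_image_of_injOn hinj,
    Nat.card_eq_fintype_card] at this

theorem isSpanningTree_restrict (hV : V(G) = Set.univ)
    (hG : ∀ e x y, G.IsLink e x y ↔ s(src e, tgt e) = s(x, y)) {F : Finset E}
    (h : IsTreeEdges src tgt F) : IsSpanningTree (G.restrict (F : Set E)) G := by
  classical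
  have hE : E(G.restrict (F : Set E)) = F := by
    ext e
    simp only [Graph.restrict]
    constructor
    · intro h; exact h.2
    · intro h; exact ⟨((hG e _ _).2 rfl).edge_mem, h⟩
  have hs : G.restrict (F : Set E) ≤s G := ⟨Graph.restrict_le, rfl⟩
  obtain ⟨hinj, hset⟩ := h.injOn_and_edgeSet_eq
  refine ⟨hs, ?_, (spanningIso hV hG hs F hE).isTree_iff.2 h.isTree⟩
  have key : ∀ {e x y}, (G.restrict (F : Set E)).IsLink e x y →
      e ∈ F ∧ s(src e, tgt e) = s(x, y) := fun hl =>
    ⟨by have := hl.edge_mem; rwa [hE] at this, (hG _ _ _).1 (hl.mono Graph.restrict_le)⟩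
  refine { not_isLoopAt := fun e x hl => ?_, eq_of_isLink := fun e f x y he hf => ?_ }
  · obtain ⟨he, hx⟩ := key hl
    have : s(x, x) ∈ (edgeGraph src tgt F).edgeSet := by
      rw [hset, ← hx]
      exact Finset.mem_coe.2 (Finset.mem_image_of_mem _ he)
    exact (SimpleGraph.mem_edgeSet _).1 this |>.ne rfl
  · exact hinj (key he).1 (key hf).1 ((key he).2.trans (key hf).2.symm)

theorem numSpanningTrees_eq_card [Fintype E] [DecidablePred (IsTreeEdges src tgt)]
    (hV : V(G) = Set.univ) (hG : ∀ e x y, G.IsLink e x y ↔ s(src e, tgt e) = s(x, y)) :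
    numSpanningTrees G = (Finset.univ.filter (IsTreeEdges src tgt)).card := by
  classical
  rw [← Fintype.card_subtype, ← Nat.card_eq_fintype_card, numSpanningTrees]
  refine Nat.card_congr (Equiv.ofBijective
    (fun H => ⟨E(H.1).toFinset, isTreeEdges_of_isSpanningTree hV hG H.2 _ (by simp)⟩) ⟨?_, ?_⟩)
  · intro H H' h
    have hE : E(H.1) = E(H'.1) := by
      have := congrArg Subtype.val h
      simpa using this
    refine Subtype.ext (Graph.Compatible.ext ?_ hE
      (Graph.Compatible.of_le_le H.2.spanning.le H'.2.spanning.le))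
    rw [H.2.spanning.vertexSet_eq, H'.2.spanning.vertexSet_eq]
  · intro F
    refine ⟨⟨_, isSpanningTree_restrict hV hG F.2⟩, Subtype.ext ?_⟩
    ext e
    refine Set.mem_toFinset.trans ?_
    exact ⟨fun h => h.2, fun h => ⟨((hG e _ _).2 rfl).edge_mem, h⟩⟩

end Bridge

/-! ### Divisibility by the order, from translation symmetry. -/

section Divisibility

variable {N : ℕ} [NeZero N] {ι : Type*}

/-- Translation of the edges of a circulant multigraph. -/
def translateEdges (N : ℕ) (ι : Type*) (a : ZMod N) : ZMod N × ι ≃ ZMod N × ι :=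
  (Equiv.addRight a).prodCongr (Equiv.refl ι)

theorem IsTreeEdges.translate {j : ι → ZMod N} {F : Finset (ZMod N × ι)}
    (h : IsTreeEdges (fun e => e.1) (fun e => e.1 + j e.2) F) (a : ZMod N) :
    IsTreeEdges (fun e => e.1) (fun e => e.1 + j e.2)
      (F.map (translateEdges N ι a).toEmbedding) := by
  refine ⟨by rw [Finset.card_map]; exact h.1, ?_⟩
  refine (SimpleGraph.Iso.connected_iff (?_ : edgeGraph _ _ F ≃g _)).1 h.2
  refine ⟨Equiv.addRight a, ?_⟩
  intro x y
  have aux : ∀ x y : ZMod N, (∃ e ∈ F.map (translateEdges N ι a).toEmbedding,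
      e.1 = x + a ∧ e.1 + j e.2 = y + a) ↔ ∃ e ∈ F, e.1 = x ∧ e.1 + j e.2 = y := by
    intro x y
    constructor
    · rintro ⟨e, he, h1, h2⟩
      obtain ⟨e', he', rfl⟩ := Finset.mem_map.1 he
      refine ⟨e', he', add_right_cancel h1, add_right_cancel (b := a) ?_⟩
      rw [← h2]
      simp [translateEdges]
      ring
    · rintro ⟨e, he, rfl, rfl⟩
      refine ⟨_, Finset.mem_map_of_mem _ he, by simp [translateEdges], ?_⟩
      simp [translateEdges]
      ring
  simp only [edgeGraph, SimpleGraph.fromRel_adj, Equiv.coe_addRight, aux, ne_eq,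
    add_left_inj]

variable [Fintype ι] [DecidableEq ι]

/-- The number of spanning trees of a circulant multigraph is divisible by its order. -/
theorem dvd_card_treeEdges (j : ι → ZMod N)
    [DecidablePred (IsTreeEdges (fun e : ZMod N × ι => e.1) (fun e => e.1 + j e.2))] :
    N ∣ (Finset.univ.filter
      (IsTreeEdges (fun e : ZMod N × ι => e.1) (fun e => e.1 + j e.2))).card := by
  set T := Finset.univ.filter
    (IsTreeEdges (fun e : ZMod N × ι => e.1) (fun e => e.1 + j e.2)) with hT
  have hcount (x : ZMod N) (i : ι) :
      (T.filter ((x, i) ∈ ·)).card = (T.filter ((0, i) ∈ ·)).card := by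
    symm
    refine Finset.card_nbij (fun F => F.map (translateEdges N ι x).toEmbedding) ?_ ?_ ?_
    · intro F hF
      simp only [Finset.coe_filter, hT, Finset.mem_filter, Finset.mem_univ, true_and,
        Set.mem_ofPred_eq] at hF ⊢
      refine ⟨hF.1.translate x, Finset.mem_map.2 ⟨_, hF.2, by simp [translateEdges]⟩⟩
    · exact fun F _ F' _ h => Finset.map_injective _ h
    · intro F hF
      simp only [Finset.coe_filter, hT, Finset.mem_filter, Finset.mem_univ, true_and,
        Set.mem_ofPred_eq] at hF
      refine ⟨F.map (translateEdges N ι (-x)).toEmbedding, ?_, ?_⟩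
      · simp only [Finset.coe_filter, hT, Finset.mem_filter, Finset.mem_univ, true_and,
          Set.mem_ofPred_eq]
        exact ⟨hF.1.translate (-x), Finset.mem_map.2 ⟨_, hF.2, by simp [translateEdges]⟩⟩
      · ext ⟨y, i'⟩
        simp [translateEdges]
  -- Double counting of pairs (tree, edge in it). As N is coprime to N - 1, it must divide the
  -- number of trees.
  have hdouble : T.card * (N - 1) = N * ∑ i, (T.filter ((0, i) ∈ ·)).card := by
    have h1 : ∑ F ∈ T, F.card = T.card * (N - 1) := by
      refine Finset.sum_const_nat fun F hF => ?_
      have := (Finset.mem_filter.1 hF).2.1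
      rw [ZMod.card] at this
      omega
    have h2 := Finset.sum_card_bipartiteAbove_eq_sum_card_bipartiteBelow
      (s := T) (t := (Finset.univ : Finset (ZMod N × ι))) (fun F e => e ∈ F)
    simp only [Finset.bipartiteAbove, Finset.bipartiteBelow, Finset.filter_univ_mem] at h2
    rw [← h1, h2, Fintype.sum_prod_type, Finset.sum_congr rfl fun x _ =>
      Finset.sum_congr rfl fun i _ => hcount x i]
    simp [ZMod.card]
  have hcop : Nat.Coprime N (N - 1) := by
    have := Nat.pos_of_neZero N
    exact (Nat.coprime_self_sub_right this).2 (Nat.coprime_one_right N)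
  exact hcop.dvd_of_dvd_mul_right (hdouble ▸ dvd_mul_right _ _)

end Divisibility

/-! ### The tree count as a product of eigenvalues. -/

section Eigenvalues

/-- With r split off and L₀ the reduced matrix, the left-hand matrix is P · diag(1, L₀) · Pᵀ, where
P has blocks 1, -1, 1, I and determinant |V|; the vanishing row and column sums recover the entries
at r. -/
theorem det_add_ones {V R : Type*} [Fintype V] [DecidableEq V] [CommRing R] (L : Matrix V V R)
    (hrow : ∀ x, ∑ y, L x y = 0) (hcol : ∀ y, ∑ x, L x y = 0) (r : V) :
    (L + Matrix.of fun _ _ => 1).det =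
      (Fintype.card V : R) ^ 2 * (L.submatrix (Subtype.val : {v // v ≠ r} → V) Subtype.val).det := by
  classical
  have hrow' (x : V) : ∑ y : {v // ¬ v = r}, L x y = - L x r := by
    have := Fintype.sum_eq_add_sum_subtype_ne (L x) r
    rw [hrow] at this
    exact (neg_eq_of_add_eq_zero_right this.symm).symm
  have hcol' (y : V) : ∑ x : {v // ¬ v = r}, L x y = - L r y := by
    have := Fintype.sum_eq_add_sum_subtype_ne (fun x => L x y) r
    rw [hcol] at this
    exact (neg_eq_of_add_eq_zero_right this.symm).symm
  let L₀ := L.submatrix (Subtype.val : {v // ¬ v = r} → V) (Subtype.val : {v // ¬ v = r} → V)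
  let P : Matrix ({v // v = r} ⊕ {v // ¬ v = r}) ({v // v = r} ⊕ {v // ¬ v = r}) R :=
    Matrix.fromBlocks 1 (Matrix.of fun _ _ => -1) (Matrix.of fun _ _ => 1) 1
  have hP : P.det = Fintype.card V := by
    have hV : Fintype.card {v // ¬ v = r} + 1 = Fintype.card V := by
      rw [Fintype.card_subtype_compl, Fintype.card_subtype_eq]
      have : 0 < Fintype.card V := Fintype.card_pos_iff.2 ⟨r⟩
      omega
    rw [Matrix.det_fromBlocks_one₂₂, Matrix.det_unique, ← hV, Matrix.sub_apply,
      Matrix.mul_apply]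
    simp only [Matrix.of_apply, Matrix.one_apply_eq, mul_one, Finset.sum_const, Finset.card_univ]
    simp [add_comm]
  have hfac : P * Matrix.fromBlocks 1 0 0 L₀ * P.transpose = Matrix.fromBlocks
      ((L + Matrix.of fun _ _ => 1).toBlock (· = r) (· = r))
      ((L + Matrix.of fun _ _ => 1).toBlock (· = r) (¬ · = r))
      ((L + Matrix.of fun _ _ => 1).toBlock (¬ · = r) (· = r))
      ((L + Matrix.of fun _ _ => 1).toBlock (¬ · = r) (¬ · = r)) := by
    rw [Matrix.fromBlocks_transpose, Matrix.fromBlocks_multiply, Matrix.fromBlocks_multiply]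
    congr 1
    · ext ⟨x, rfl⟩ ⟨y, rfl⟩
      simp [Matrix.mul_apply, L₀, hcol', hrow', Matrix.toBlock_apply, add_comm]
    · ext ⟨x, rfl⟩ y
      simp [Matrix.mul_apply, L₀, hcol', Matrix.toBlock_apply, add_comm]
    · ext x ⟨y, rfl⟩
      simp [Matrix.mul_apply, L₀, hrow', Matrix.toBlock_apply, add_comm]
    · ext x y
      simp [Matrix.mul_apply, L₀, Matrix.toBlock_apply, add_comm]
  have hdet := congrArg Matrix.det hfac
  rw [Matrix.det_mul, Matrix.det_mul, Matrix.det_transpose, hP, Matrix.det_fromBlocks_zero₂₁,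
    Matrix.det_one, one_mul, mul_right_comm, ← sq] at hdet
  rw [Matrix.det_toBlock _ (· = r)]
  refine Eq.trans ?_ hdet.symm
  congr!

variable {N : ℕ} [NeZero N] {ι K : Type*} [Fintype ι] [Field K] [CharZero K]

/-- The Laplacian eigenvalue of a circulant multigraph at the character `x ↦ ψ (x * k)`. -/
def circEigenvalue (ψ : AddChar (ZMod N) K) (j : ι → ZMod N) (k : ZMod N) : K :=
  ∑ i, (ψ (-(j i * k)) - 1) * (ψ (j i * k) - 1)

/-- The characters are eigenvectors, and form an invertible matrix by orthogonality. The all-ones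
matrix only changes the eigenvalue of the trivial character, from 0 to N. -/
theorem det_circulant_laplacian_add_ones {ψ : AddChar (ZMod N) K} (hψ : ψ.IsPrimitive)
    (j : ι → ZMod N) :
    (((signedInc (fun e : ZMod N × ι => e.1) (fun e => e.1 + j e.2) *
      (signedInc (fun e : ZMod N × ι => e.1) (fun e => e.1 + j e.2)).transpose +
      Matrix.of fun _ _ => 1).det : ℤ) : K) =
      N * ∏ k ∈ Finset.univ.erase 0, circEigenvalue ψ j k := by
  set B := signedInc (fun e : ZMod N × ι => e.1) (fun e => e.1 + j e.2) with hB
  let F : Matrix (ZMod N) (ZMod N) K := Matrix.of fun x k => ψ (x * k)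
  let F' : Matrix (ZMod N) (ZMod N) K := Matrix.of fun k x => ψ (-(k * x))
  have hF : F.det ≠ 0 := by
    have hFF : F * F' = (N : K) • 1 := by
      ext x y
      have h := AddChar.sum_mulShift (x - y) hψ
      rw [Matrix.mul_apply, Matrix.smul_apply, Matrix.one_apply]
      simp only [F, F', Matrix.of_apply, ← AddChar.map_add_eq_mul]
      rw [ZMod.card] at h
      simp only [sub_eq_zero] at h
      rw [← Finset.sum_congr rfl fun k _ => congrArg ψ
        (show k * (x - y) = x * k + -(k * y) by ring), h]
      split_ifs <;> simp
    have := congrArg Matrix.det hFF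
    rw [Matrix.det_mul, Matrix.det_smul, Matrix.det_one, mul_one] at this
    intro h0
    rw [h0, zero_mul] at this
    exact pow_ne_zero _ (NeZero.ne (N : K)) this.symm
  let μ : ZMod N → K := fun k => circEigenvalue ψ j k + if k = 0 then (N : K) else 0
  have hinc (g : ZMod N → K) (e : ZMod N × ι) :
      ∑ y, (B y e : K) * g y = g (e.1 + j e.2) - g e.1 := by
    simp [hB, signedInc, sub_mul]
  have heig : (B * B.transpose + Matrix.of fun _ _ => 1).map (Int.cast : ℤ → K) * F =
      F * Matrix.diagonal μ := by
    ext x k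
    rw [Matrix.mul_diagonal, Matrix.mul_apply]
    have h1 : ∑ y, ψ (y * k) = if k = 0 then (N : K) else 0 := by
      have h := AddChar.sum_mulShift k hψ
      rw [ZMod.card] at h
      rw [h]; split_ifs <;> simp
    have h2 : ∑ y, (∑ e, (B x e : K) * B y e) * ψ (y * k) = ψ (x * k) * circEigenvalue ψ j k := by
      simp only [Finset.sum_mul]
      rw [Finset.sum_comm]
      simp only [mul_assoc, ← Finset.mul_sum]
      rw [Finset.sum_congr rfl fun e _ => by rw [hinc (fun y => ψ (y * k)) e]]
      rw [Fintype.sum_prod_type_right, circEigenvalue, Finset.mul_sum]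
      refine Finset.sum_congr rfl fun i _ => ?_
      simp only [hB, signedInc, Matrix.of_apply, Int.cast_sub, Int.cast_ite, Int.cast_one,
        Int.cast_zero, sub_mul, Finset.sum_sub_distrib, ite_mul, one_mul, zero_mul]
      have h3 : ∀ z, z + j i = x ↔ z = x - j i := fun z => eq_sub_iff_add_eq.symm
      simp only [h3, Finset.sum_ite_eq', Finset.mem_univ, if_true]
      simp only [sub_mul, add_mul, sub_add_cancel, mul_sub, AddChar.map_add_eq_mul]
      rw [sub_eq_add_neg (x * k), AddChar.map_add_eq_mul]
      have h4 : ψ (-(j i * k)) * ψ (j i * k) = 1 := by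
        rw [← AddChar.map_add_eq_mul]; simp
      linear_combination (-ψ (x * k)) * h4
    simp only [Matrix.map_apply, Matrix.add_apply, Matrix.of_apply, Matrix.mul_apply,
      Matrix.transpose_apply, Int.cast_add, Int.cast_sum, Int.cast_mul, Int.cast_one, add_mul,
      one_mul, Finset.sum_add_distrib, F, μ]
    rw [h1, h2]
    split_ifs with hk <;> simp [hk, mul_add]
  have hdet := congrArg Matrix.det heig
  rw [Matrix.det_mul, Matrix.det_mul, mul_comm, Matrix.det_diagonal] at hdet
  have hdet' := mul_left_cancel₀ hF hdet
  rw [Int.cast_det, hdet', ← Finset.mul_prod_erase _ _ (Finset.mem_univ 0)]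
  congr 1
  · simp [μ, circEigenvalue]
  · refine Finset.prod_congr rfl fun k hk => ?_
    simp [μ, Finset.ne_of_mem_erase hk]

theorem card_mul_card_treeEdges [DecidableEq ι] {ψ : AddChar (ZMod N) K} (hψ : ψ.IsPrimitive) (j : ι → ZMod N)
    [DecidablePred (IsTreeEdges (fun e : ZMod N × ι => e.1) (fun e => e.1 + j e.2))] :
    (N : K) * (Finset.univ.filter
      (IsTreeEdges (fun e : ZMod N × ι => e.1) (fun e => e.1 + j e.2))).card =
      ∏ k ∈ Finset.univ.erase 0, circEigenvalue ψ j k := by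
  have h1 := det_circulant_laplacian_add_ones hψ j
  have hzero (e : ZMod N × ι) :
      ∑ y, signedInc (fun e : ZMod N × ι => e.1) (fun e => e.1 + j e.2) y e = 0 := by
    simp [signedInc]
  rw [det_add_ones _ ?_ ?_ 0, det_reduced_laplacian, ZMod.card] at h1
  · push_cast at h1
    rw [sq, mul_assoc] at h1
    exact mul_left_cancel₀ (NeZero.ne (N : K)) h1
  · intro x
    simp only [Matrix.mul_apply, Matrix.transpose_apply]
    rw [Finset.sum_comm]
    simp [← Finset.mul_sum, hzero]
  · intro x
    simp only [Matrix.mul_apply, Matrix.transpose_apply]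
    rw [Finset.sum_comm]
    simp [← Finset.sum_mul, hzero]

end Eigenvalues

/-! ### Products of even functions over half of ℤ/N. -/

section HalfProduct

variable {N : ℕ} {M : Type*} [CommMonoid M] {g : ZMod N → M}

theorem prod_erase_zero_eq_prod_Ico [NeZero N] (g : ZMod N → M) :
    ∏ k ∈ Finset.univ.erase 0, g k = ∏ a ∈ Finset.Ico 1 N, g (a : ZMod N) := by
  refine Finset.prod_nbij' (fun k => k.val) (fun a => (a : ZMod N)) ?_ ?_ ?_ ?_ ?_
  · intro k hk
    have h0 : k.val ≠ 0 := (ZMod.val_ne_zero k).2 (Finset.ne_of_mem_erase hk)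
    exact Finset.mem_Ico.2 ⟨by omega, ZMod.val_lt k⟩
  · intro a ha
    rw [Finset.mem_Ico] at ha
    refine Finset.mem_erase.2 ⟨fun h => ?_, Finset.mem_univ _⟩
    have := Nat.le_of_dvd (by omega) ((ZMod.natCast_eq_zero_iff a N).1 h)
    omega
  · intro k _
    simp
  · intro a ha
    exact ZMod.val_cast_of_lt (Finset.mem_Ico.1 ha).2
  · intro k _
    simp

theorem prod_Ico_top_half (hg : ∀ k, g (-k) = g k) {m : ℕ} (hm : m + 1 ≤ N + 1) :
    ∏ a ∈ Finset.Ico (N - m) N, g (a : ZMod N) = ∏ a ∈ Finset.Ico 1 (m + 1), g (a : ZMod N) := by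
  have h := Finset.prod_Ico_reflect (fun a : ℕ => g (a : ZMod N)) 1 hm
  rw [Nat.add_sub_cancel, Nat.add_sub_add_right] at h
  rw [← h]
  refine Finset.prod_congr rfl fun a ha => ?_
  rw [Nat.cast_sub (by have := Finset.mem_Ico.1 ha; omega)]
  simp [hg]

variable [NeZero N]

theorem prod_erase_zero_of_odd (hg : ∀ k, g (-k) = g k) {m : ℕ} (hN : N = 2 * m + 1) :
    ∏ k ∈ Finset.univ.erase 0, g k = (∏ a ∈ Finset.Ico 1 (m + 1), g (a : ZMod N)) ^ 2 := by
  rw [prod_erase_zero_eq_prod_Ico, ← Finset.prod_Ico_consecutive _ (show 1 ≤ m + 1 by omega)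
    (show m + 1 ≤ N by omega), sq, ← prod_Ico_top_half hg (show m + 1 ≤ N + 1 by omega),
    show N - m = m + 1 by omega]

theorem prod_erase_zero_of_even (hg : ∀ k, g (-k) = g k) {m : ℕ} (hN : N = 2 * (m + 1)) :
    ∏ k ∈ Finset.univ.erase 0, g k =
      (∏ a ∈ Finset.Ico 1 (m + 1), g (a : ZMod N)) ^ 2 * g ((m + 1 : ℕ) : ZMod N) := by
  rw [prod_erase_zero_eq_prod_Ico, ← Finset.prod_Ico_consecutive _ (show 1 ≤ m + 2 by omega)
    (show m + 2 ≤ N by omega), Finset.prod_Ico_succ_top (by omega), sq, mul_right_comm]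
  congr 2
  rw [← prod_Ico_top_half hg (show m + 1 ≤ N + 1 by omega), show N - m = m + 2 by omega]

/-- An even function has the same product over half a residue system and over a unit multiple. -/
theorem prod_half_unit_mul (hg : ∀ k, g (-k) = g k) (u : (ZMod N)ˣ) {m : ℕ}
    (hN : N = 2 * m + 1 ∨ N = 2 * (m + 1)) :
    ∏ a ∈ Finset.Ico 1 (m + 1), g (u * (a : ZMod N)) =
      ∏ a ∈ Finset.Ico 1 (m + 1), g (a : ZMod N) := by
  classical
  -- The representative of ±ua in [0, N/2]; it permutes the half system.
  let f : ℕ → ℕ := fun a => ((u : ZMod N) * (a : ZMod N)).valMinAbs.natAbs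
  have hf (a : ℕ) : ((f a : ℕ) : ZMod N) = u * (a : ZMod N) ∨
      ((f a : ℕ) : ZMod N) = -(u * (a : ZMod N)) := by
    have h := ZMod.coe_valMinAbs ((u : ZMod N) * (a : ZMod N))
    rcases Int.natAbs_eq ((u : ZMod N) * (a : ZMod N)).valMinAbs with h' | h'
    · left; rw [← h]; rw [h']; simp [f]
    · right; rw [← h]; rw [h']; simp [f]
  have hnz (b : ℕ) (h1 : 0 < b) (h2 : b < N) : (b : ZMod N) ≠ 0 := fun h => by
    have := Nat.le_of_dvd h1 ((ZMod.natCast_eq_zero_iff b N).1 h)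
    omega
  have hmaps : ∀ a ∈ Finset.Ico 1 (m + 1), f a ∈ Finset.Ico 1 (m + 1) := by
    intro a ha
    rw [Finset.mem_Ico] at ha
    have hle : f a ≤ N / 2 := ZMod.natAbs_valMinAbs_le _
    have h0 : f a ≠ 0 := fun h => by
      have := hf a
      rw [h] at this
      exact hnz a (by omega) (by omega) (by simpa [eq_comm] using this)
    -- The value N/2 would give 2ua = 0, hence 2a = 0, although 0 < 2a < N.
    have htop : 2 * f a ≠ N := fun h => by
      have h3 : (2 : ZMod N) * (f a : ℕ) = 0 := by
        have := congrArg (Nat.cast : ℕ → ZMod N) h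
        push_cast at this
        rwa [ZMod.natCast_self] at this
      have h4 : (u : ZMod N) * ((2 * a : ℕ) : ZMod N) = 0 := by
        push_cast
        rcases hf a with h' | h' <;> rw [h'] at h3
        · linear_combination h3
        · linear_combination -h3
      rw [Units.mul_right_eq_zero] at h4
      exact hnz (2 * a) (by omega) (by omega) h4
    rw [Finset.mem_Ico]
    omega
  have hinj : Set.InjOn f (Finset.Ico 1 (m + 1) : Finset ℕ) := by
    intro a ha b hb hab
    rw [Finset.mem_coe, Finset.mem_Ico] at ha hb
    have key : (u : ZMod N) * (a : ZMod N) = u * (b : ZMod N) ∨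
        (u : ZMod N) * (a : ZMod N) = -(u * (b : ZMod N)) := by
      have h1 := hf a
      have h2 := hf b
      rw [← hab] at h2
      rcases h1 with h1 | h1 <;> rcases h2 with h2 | h2 <;> rw [h1] at h2
      · exact Or.inl h2
      · exact Or.inr h2
      · exact Or.inr (neg_eq_iff_eq_neg.1 h2)
      · exact Or.inl (neg_injective h2)
    rcases key with h | h
    · have := (Units.mul_right_inj u).1 h
      have := congrArg ZMod.val this
      rwa [ZMod.val_cast_of_lt (by omega), ZMod.val_cast_of_lt (by omega)] at this
    · rw [← mul_neg] at h
      have := (Units.mul_right_inj u).1 h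
      exact absurd (show ((a + b : ℕ) : ZMod N) = 0 by push_cast; rw [this]; ring)
        (hnz (a + b) (by omega) (by omega))
  have himage : (Finset.Ico 1 (m + 1)).image f = Finset.Ico 1 (m + 1) :=
    Finset.eq_of_subset_of_card_le (Finset.image_subset_iff.2 hmaps)
      (Finset.card_image_of_injOn hinj).ge
  conv_rhs => rw [← himage, Finset.prod_image hinj]
  refine Finset.prod_congr rfl fun a _ => ?_
  rcases hf a with h | h <;> rw [h]
  rw [hg]

end HalfProduct

/-! ### Rationality of the half product. -/

section Rationality

variable {N : ℕ} {ι K : Type*} [Fintype ι] [Field K]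

theorem circEigenvalue_neg (ψ : AddChar (ZMod N) K) (j : ι → ZMod N) (k : ZMod N) :
    circEigenvalue ψ j (-k) = circEigenvalue ψ j k := by
  simp [circEigenvalue, mul_comm]

variable [NeZero N]

/-- Since ζ^h = -1, a jump j contributes ((-1)^j - 1)², which is 4 or 0. -/
theorem circEigenvalue_half {ζ : K} (hζ : IsPrimitiveRoot ζ N) {h : ℕ} (hN : N = 2 * h)
    (j : ι → ℕ) :
    circEigenvalue (AddChar.zmodChar N hζ.pow_eq_one) (fun i => (j i : ZMod N)) (h : ZMod N) =
      4 * (Finset.univ.filter fun i => Odd (j i)).card := by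
  set ψ := AddChar.zmodChar N hζ.pow_eq_one
  have hneg : ζ ^ h = -1 :=
    (hζ.pow (Nat.pos_of_neZero N) (by rw [hN, mul_comm])).eq_neg_one_of_two_right
  have hψ (i : ι) : ψ ((j i : ZMod N) * h) = (-1) ^ j i := by
    rw [← Nat.cast_mul, AddChar.zmodChar_apply', mul_comm, pow_mul, hneg]
  have hψ' (i : ι) : ψ (-((j i : ZMod N) * h)) = (-1) ^ j i := by
    rw [AddChar.map_neg_eq_inv, hψ, ← inv_pow, inv_neg, inv_one]
  have hterm (i : ι) : ((-1 : K) ^ j i - 1) * ((-1) ^ j i - 1) = if Odd (j i) then 4 else 0 := by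
    split_ifs with ho
    · rw [ho.neg_one_pow]; norm_num
    · rw [(Nat.not_odd_iff_even.1 ho).neg_one_pow]; norm_num
  simp only [circEigenvalue, hψ, hψ', hterm]
  rw [← Finset.sum_filter, Finset.sum_const, nsmul_eq_mul, mul_comm]

/-- An automorphism raises ζ to a unit power u, so it replaces each factor at a by the factor at ua;
the product is Galois-invariant. -/
theorem exists_rat_eq_half_product {K : Type*} [Field K] [CharZero K]
    [IsCyclotomicExtension {N} ℚ K] {ζ : K}
    (hζ : IsPrimitiveRoot ζ N) (j : ι → ZMod N) {m : ℕ}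
    (hN : N = 2 * m + 1 ∨ N = 2 * (m + 1)) :
    ∃ c : ℚ, (c : K) = ∏ a ∈ Finset.Ico 1 (m + 1),
      circEigenvalue (AddChar.zmodChar N hζ.pow_eq_one) j (a : ZMod N) := by
  set ψ := AddChar.zmodChar N hζ.pow_eq_one
  have : IsGalois ℚ K := IsCyclotomicExtension.isGalois {N} ℚ K
  have : FiniteDimensional ℚ K := IsCyclotomicExtension.finiteDimensional {N} ℚ K
  suffices h : (∏ a ∈ Finset.Ico 1 (m + 1), circEigenvalue ψ j (a : ZMod N)) ∈
      (⊥ : IntermediateField ℚ K) by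
    obtain ⟨c, hc⟩ := IntermediateField.mem_bot.1 h
    exact ⟨c, by rw [← hc]; rfl⟩
  rw [IsGalois.mem_bot_iff_fixed]
  intro σ
  set u := hζ.autToPow ℚ σ with hu
  have hσψ (x : ZMod N) : σ (ψ x) = ψ (u * x) := by
    have h1 : σ ζ = ψ u := by
      rw [← hζ.autToPow_spec ℚ σ, AddChar.zmodChar_apply]
    rw [AddChar.zmodChar_apply, map_pow, h1, ← AddChar.map_nsmul_eq_pow, nsmul_eq_mul,
      ZMod.natCast_zmod_val, mul_comm]
  rw [map_prod, ← prod_half_unit_mul (circEigenvalue_neg ψ j) u hN]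
  refine Finset.prod_congr rfl fun a _ => ?_
  simp only [circEigenvalue, map_sum, map_mul, map_sub, map_one, hσψ]
  refine Finset.sum_congr rfl fun i _ => ?_
  rw [mul_neg, mul_left_comm]

variable [DecidableEq ι]

theorem exists_rat_sq_of_odd (hN : Odd N) (j : ι → ZMod N)
    [DecidablePred (IsTreeEdges (fun e : ZMod N × ι => e.1) (fun e => e.1 + j e.2))] :
    ∃ c : ℚ, (N : ℚ) * (Finset.univ.filter
      (IsTreeEdges (fun e : ZMod N × ι => e.1) (fun e => e.1 + j e.2))).card = c ^ 2 := by
  obtain ⟨m, hm⟩ := hN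
  have : IsCyclotomicExtension {N} ℚ (CyclotomicField N ℚ) :=
    CyclotomicField.isCyclotomicExtension N ℚ
  have hζ := IsCyclotomicExtension.zeta_spec N ℚ (CyclotomicField N ℚ)
  obtain ⟨c, hc⟩ := exists_rat_eq_half_product hζ j (Or.inl hm)
  have h := card_mul_card_treeEdges (AddChar.zmodChar_primitive_of_primitive_root N hζ) j
  rw [prod_erase_zero_of_odd (circEigenvalue_neg _ j) hm, ← hc] at h
  exact ⟨c, by exact_mod_cast h⟩

theorem exists_rat_sq_of_even (hN : Even N) (j : ι → ℕ)
    [DecidablePred (IsTreeEdges (fun e : ZMod N × ι => e.1) (fun e => e.1 + (j e.2 : ZMod N)))] :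
    ∃ c : ℚ, (N : ℚ) * (Finset.univ.filter
      (IsTreeEdges (fun e : ZMod N × ι => e.1) (fun e => e.1 + (j e.2 : ZMod N)))).card =
        (Finset.univ.filter fun i => Odd (j i)).card * c ^ 2 := by
  obtain ⟨m, hm⟩ : ∃ m, N = 2 * (m + 1) := by
    obtain ⟨h, hh⟩ := hN
    have := NeZero.ne N
    exact ⟨h - 1, by omega⟩
  have : IsCyclotomicExtension {N} ℚ (CyclotomicField N ℚ) :=
    CyclotomicField.isCyclotomicExtension N ℚ
  have hζ := IsCyclotomicExtension.zeta_spec N ℚ (CyclotomicField N ℚ)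
  obtain ⟨c, hc⟩ := exists_rat_eq_half_product hζ (fun i => (j i : ZMod N)) (Or.inr hm)
  have h := card_mul_card_treeEdges (AddChar.zmodChar_primitive_of_primitive_root N hζ)
    (fun i => (j i : ZMod N))
  rw [prod_erase_zero_of_even (circEigenvalue_neg _ _) hm, circEigenvalue_half hζ hm j, ← hc] at h
  -- The 2 absorbs the factor 4 of the middle eigenvalue.
  refine ⟨2 * c, ?_⟩
  have h' : (N : ℚ) * (Finset.univ.filter
      (IsTreeEdges (fun e : ZMod N × ι => e.1) (fun e => e.1 + (j e.2 : ZMod N)))).card =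
        c ^ 2 * (4 * (Finset.univ.filter fun i => Odd (j i)).card) := by exact_mod_cast h
  rw [h']; ring

end Rationality

/-! ### From rational to integral squares. -/

section Arithmetic

/-- The squared denominator of y is coprime to the squared numerator, so it divides r and must be 1.
-/
theorem exists_int_of_squarefree_mul_sq {r m : ℕ} (hr : Squarefree r) {y : ℚ}
    (h : (m : ℚ) = r * y ^ 2) : ∃ a : ℤ, (m : ℤ) = r * a ^ 2 := by
  have hden : (y.den : ℚ) ≠ 0 := by exact_mod_cast y.den_ne_zero
  have h1 : (m : ℚ) * (y.den : ℚ) ^ 2 = r * (y.num : ℚ) ^ 2 := by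
    rw [h, mul_assoc, ← mul_pow, Rat.mul_den_eq_num]
  have h2 : m * y.den ^ 2 = r * y.num.natAbs ^ 2 := by
    zify
    rw [sq_abs]
    exact_mod_cast h1
  have hdvd : y.den * y.den ∣ r := by
    rw [← sq]
    exact (Nat.Coprime.pow 2 2 y.reduced.symm).dvd_of_dvd_mul_right (h2 ▸ dvd_mul_left _ _)
  have hone : y.den = 1 := Nat.isUnit_iff.1 (hr _ hdvd)
  refine ⟨y.num, ?_⟩
  rw [hone] at h1
  simp only [Nat.cast_one, one_pow, mul_one] at h1
  exact_mod_cast h1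

theorem exists_eq_mul_sq {N τ d D : ℕ} (hN : N ≠ 0) (hdvd : N ∣ τ) (hd : IsSquarefreePart d D)
    {c : ℚ} (h : (N : ℚ) * τ = D * c ^ 2) : ∃ a : ℤ, (τ : ℤ) = N * d * a ^ 2 := by
  obtain ⟨m, rfl⟩ := hdvd
  obtain ⟨hsq, u, rfl⟩ := hd
  have hN' : (N : ℚ) ≠ 0 := by exact_mod_cast hN
  obtain ⟨a, ha⟩ := exists_int_of_squarefree_mul_sq (m := m) (y := u * c / N) hsq (by
    push_cast at h
    field_simp
    linear_combination h)
  exact ⟨a, by push_cast; rw [ha]; ring⟩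

theorem card_filter_odd_sumElim {k l : ℕ} (s : Fin k → ℕ) (α : Fin l → ℕ) (n : ℕ) :
    (Finset.univ.filter fun i => Odd (Sum.elim s (fun m => α m * n) i)).card =
      numOdd s + (Finset.univ.filter fun m => Odd (α m * n)).card := by
  rw [numOdd, Finset.card_filter, Fintype.sum_sum_type, Finset.card_filter, Finset.card_filter]
  rfl

end Arithmetic

/-! ### The three parity cases. -/

theorem theorem2 (β k l : ℕ) (hβ : 0 < β) (s : Fin k → ℕ) (α : Fin l → ℕ)
    (hs : StrictMono s) (hs_pos : ∀ i, 1 ≤ s i)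
    (hα : StrictMono α) (hα_bd : ∀ m, 1 ≤ α m ∧ α m ≤ β / 2)
    (p q r t : ℕ) (hp : p = numOdd s) (hq : q = numOdd α)
    (hr : IsSquarefreePart r p) (ht : IsSquarefreePart t (p + q)) :
    ∃ a : ℕ → ℤ, ∀ n : ℕ, 0 < n → (∀ i, s i ≤ β * n / 2) →
      (Odd n → Odd β →
        (numSpanningTrees (circulantNonFixed β n s α) : ℤ) = β * n * a n ^ 2) ∧
      (Even n →
        (numSpanningTrees (circulantNonFixed β n s α) : ℤ) = β * r * n * a n ^ 2) ∧
      (Odd n → Even β →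
        (numSpanningTrees (circulantNonFixed β n s α) : ℤ) = β * t * n * a n ^ 2) := by
  classical
  suffices H : ∀ n : ℕ, ∃ a : ℤ, 0 < n →
      (Odd n → Odd β →
        (numSpanningTrees (circulantNonFixed β n s α) : ℤ) = β * n * a ^ 2) ∧
      (Even n →
        (numSpanningTrees (circulantNonFixed β n s α) : ℤ) = β * r * n * a ^ 2) ∧
      (Odd n → Even β →
        (numSpanningTrees (circulantNonFixed β n s α) : ℤ) = β * t * n * a ^ 2) by
    choose a ha using H
    exact ⟨a, fun n hn _ => ha n hn⟩
  intro n
  rcases Nat.eq_zero_or_pos n with rfl | hn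
  · exact ⟨0, fun h => absurd h (lt_irrefl 0)⟩
  have hN : β * n ≠ 0 := (Nat.mul_pos hβ hn).ne'
  have : NeZero (β * n) := ⟨hN⟩
  set j : Fin k ⊕ Fin l → ℕ := Sum.elim s (fun m => α m * n) with hj
  have hτ : numSpanningTrees (circulantNonFixed β n s α) = (Finset.univ.filter
      (IsTreeEdges (fun e : ZMod (β * n) × (Fin k ⊕ Fin l) => e.1)
        (fun e => e.1 + (j e.2 : ZMod (β * n))))).card :=
    numSpanningTrees_eq_card rfl fun _ _ _ => Iff.rfl
  have hdvd := dvd_card_treeEdges (fun i => (j i : ZMod (β * n)))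
  have hodd := card_filter_odd_sumElim s α n
  rw [← hτ] at hdvd
  rcases Nat.even_or_odd n with hne | hno
  · obtain ⟨c, hc⟩ := exists_rat_sq_of_even (N := β * n) (hne.mul_left β) j
    have hcard : (Finset.univ.filter fun i => Odd (j i)).card = p := by
      rw [hodd, hp, Finset.filter_false_of_mem, Finset.card_empty, add_zero]
      exact fun m _ => Nat.not_odd_iff_even.2 (hne.mul_left _)
    rw [hcard, ← hτ] at hc
    obtain ⟨a, ha⟩ := exists_eq_mul_sq hN hdvd hr hc
    refine ⟨a, fun _ => ⟨fun h => absurd hne (Nat.not_even_iff_odd.2 h), fun _ => ?_,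
      fun h => absurd hne (Nat.not_even_iff_odd.2 h)⟩⟩
    rw [ha]; push_cast; ring
  · rcases Nat.even_or_odd β with hβe | hβo
    · obtain ⟨c, hc⟩ := exists_rat_sq_of_even (N := β * n) (hβe.mul_right n) j
      have hcard : (Finset.univ.filter fun i => Odd (j i)).card = p + q := by
        rw [hodd, hp, hq]
        simp only [numOdd, Nat.odd_mul, hno, and_true]
      rw [hcard, ← hτ] at hc
      obtain ⟨a, ha⟩ := exists_eq_mul_sq hN hdvd ht hc
      refine ⟨a, fun _ => ⟨fun _ h => absurd hβe (Nat.not_even_iff_odd.2 h),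
        fun h => absurd h (Nat.not_even_iff_odd.2 hno), fun _ _ => ?_⟩⟩
      rw [ha]; push_cast; ring
    · obtain ⟨c, hc⟩ := exists_rat_sq_of_odd (hβo.mul hno) (fun i => (j i : ZMod (β * n)))
      rw [← hτ] at hc
      -- For odd N there is no middle eigenvalue, so the square-free factor is 1.
      obtain ⟨a, ha⟩ := exists_eq_mul_sq (d := 1) (D := 1) (c := c) hN hdvd
        ⟨squarefree_one, 1, rfl⟩ (by rw [hc]; simp)
      refine ⟨a, fun _ => ⟨fun _ _ => ?_, fun h => absurd h (Nat.not_even_iff_odd.2 hno),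
        fun _ h => absurd h (Nat.not_even_iff_odd.2 hβo)⟩⟩
      rw [ha]; push_cast; ring
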